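/- Let $(M,h)$ be a smooth Riemannian manifold (finite-dimensional, without boundary) with Levi-Civita connection $D$, let $\xi$ be a Killing vector field on $M$, that is, a $C^\infty$ vector field with $h(D_u\xi,v)+h(D_v\xi,u)=0$ (in indices $D_i\xi_j+D_j\xi_i=0$) for all tangent vectors $u,v$ at the same point, and put $f:=\tfrac12 h(\xi,\xi)=\tfrac12\,\xi_i\xi^i$. Let $R(X,Y)Z=D_XD_YZ-D_YD_XZ-D_{[X,Y]}Z$ and let $R_{iljm}$ be the Riemann tensor with the sign convention $R_{iljm}\,u^i\xi^l v^j\xi^m = h(R(u,\xi)\xi,v)$ (so that round spheres have positive curvature). Then $$D_iD_jf = D_i\xi^m\,D_j\xi_m - R_{iljm}\,\xi^l\xi^m ,$$ that is, $\operatorname{Hess}f(u,v)=h(D_u\xi,D_v\xi)-R(u,\xi,v,\xi)$ for all tangent vectors $u,v$ at the same point. Moreover, if $R_{iljm}\,\xi^l\xi^m\le 0$, i.e. $R(u,\xi,u,\xi)\le 0$ for every tangent vector $u$ at every point, then $f$ is convex (strict convexity is not claimed), i.e. $f$ is $C^\infty$ and $\operatorname{Hess}f(u,u)\ge 0$ for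 every tangent vector $u$. -/

import Mathlib

/-!
Levi-Civita connection, gradient, Hessian, Riemann curvature tensor, Killing fields and convex
functions on a smooth Riemannian manifold `M` modelled on a finite-dimensional real vector space.

Conventions: for a covariant derivative `D`, Mathlib writes `D Y x u` for `(∇_u Y)(x)`;
`mvfderiv I f x u` is the derivative `df_x(u)` of a vector-valued function `f`; the class
`RiemannianBundle` carries the metric, and `inner ℝ u v` is its value on tangent vectors at the
same point; `mlieBracket I X Y` is the Lie bracket `[X, Y]`; `MDiffAt (T% X) x` says that the
vector field `X` is differentiable at `x`.
-/

namespace RiemGeom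

open Bundle VectorField FiberBundle
open scoped Manifold ContDiff

noncomputable section

set_option linter.unusedSectionVars false

variable {E : Type*} [NormedAddCommGroup E] [NormedSpace ℝ E] [FiniteDimensional ℝ E]
  {H : Type*} [TopologicalSpace H] {I : ModelWithCorners ℝ E H}
  {M : Type*} [TopologicalSpace M] [ChartedSpace H M] [IsManifold I ∞ M]
  [RiemannianBundle (fun x : M ↦ TangentSpace I x)]
  [IsContMDiffRiemannianBundle I ∞ E (fun x : M ↦ TangentSpace I x)]

/-! ### The Levi-Civita connection -/

theorem mdifferentiableAt_inner {x : M} {X Y : Π x : M, TangentSpace I x}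
    (hX : MDiffAt (T% X) x) (hY : MDiffAt (T% Y) x) :
    MDiffAt (fun y ↦ inner ℝ (X y) (Y y)) x := by
  have : IsContMDiffRiemannianBundle I 1 E (fun x : M ↦ TangentSpace I x) :=
    IsContMDiffRiemannianBundle.of_le (n := ∞) (by norm_cast)
  exact MDifferentiableAt.inner_bundle (IB := I) (F := E) (E := fun x : M ↦ TangentSpace I x) hX hY

/-- The right-hand side of the Koszul formula for `⟨∇_X Y, Z⟩` at the point `x`:
`½ (X⟨Y, Z⟩ + Y⟨Z, X⟩ - Z⟨X, Y⟩ + ⟨[X, Y], Z⟩ - ⟨[Y, Z], X⟩ + ⟨[Z, X], Y⟩)`. -/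
def koszul (Y X Z : Π x : M, TangentSpace I x) (x : M) : ℝ :=
  2⁻¹ * (mvfderiv I (fun y ↦ inner ℝ (Y y) (Z y)) x (X x)
    + mvfderiv I (fun y ↦ inner ℝ (Z y) (X y)) x (Y x)
    - mvfderiv I (fun y ↦ inner ℝ (X y) (Y y)) x (Z x)
    + inner ℝ (mlieBracket I X Y x) (Z x)
    - inner ℝ (mlieBracket I Y Z x) (X x)
    + inner ℝ (mlieBracket I Z X x) (Y x))

theorem koszul_tensorial_left {x : M} {Y Z : Π x : M, TangentSpace I x}
    (hY : MDiffAt (T% Y) x) (hZ : MDiffAt (T% Z) x) :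
    TensorialAt I E (fun X ↦ koszul Y X Z x) x where
  smul {f X} hf hX := by
    have h1 := mvfderiv_fun_mul hf (mdifferentiableAt_inner hZ hX)
    have h2 := mvfderiv_fun_mul hf (mdifferentiableAt_inner hX hY)
    simp [koszul, inner_smul_left, inner_smul_right, inner_add_left, h1, h2,
      mlieBracket_smul_left hf hX, mlieBracket_smul_right hf hX]
    rw [real_inner_comm (Z x) (X x)]
    ring
  add {X X'} hX hX' := by
    have h1 := mvfderiv_fun_add (mdifferentiableAt_inner hZ hX) (mdifferentiableAt_inner hZ hX')
    have h2 := mvfderiv_fun_add (mdifferentiableAt_inner hX hY) (mdifferentiableAt_inner hX' hY)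
    simp [koszul, inner_add_left, inner_add_right, h1, h2, mlieBracket_add_left hX hX',
      mlieBracket_add_right hX hX']
    ring

theorem koszul_tensorial_right {x : M} {Y X : Π x : M, TangentSpace I x}
    (hY : MDiffAt (T% Y) x) (hX : MDiffAt (T% X) x) :
    TensorialAt I E (fun Z ↦ koszul Y X Z x) x where
  smul {f Z} hf hZ := by
    have h1 := mvfderiv_fun_mul hf (mdifferentiableAt_inner hY hZ)
    have h2 := mvfderiv_fun_mul hf (mdifferentiableAt_inner hZ hX)
    simp [koszul, inner_smul_left, inner_smul_right, inner_add_left, h1, h2,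
      mlieBracket_smul_left hf hZ, mlieBracket_smul_right hf hZ]
    rw [real_inner_comm (Y x) (Z x)]
    ring
  add {Z Z'} hZ hZ' := by
    have h1 := mvfderiv_fun_add (mdifferentiableAt_inner hY hZ) (mdifferentiableAt_inner hY hZ')
    have h2 := mvfderiv_fun_add (mdifferentiableAt_inner hZ hX) (mdifferentiableAt_inner hZ' hX)
    simp [koszul, inner_add_left, inner_add_right, h1, h2, mlieBracket_add_left hZ hZ',
      mlieBracket_add_right hZ hZ']
    ring

/-- `u ↦ (∇_u Y)(x)`: the linear map obtained from the Koszul formula by the Riesz isomorphism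
`T_xM* ≃ T_xM` if `Y` is differentiable at `x`, and `0` otherwise. -/
def leviCivitaFun (Y : Π x : M, TangentSpace I x) (x : M) :
    TangentSpace I x →L[ℝ] TangentSpace I x :=
  haveI : FiniteDimensional ℝ (TangentSpace I x) := inferInstanceAs (FiniteDimensional ℝ E)
  haveI : CompleteSpace (TangentSpace I x) := FiniteDimensional.complete ℝ _
  open scoped Classical in
  if hY : MDiffAt (T% Y) x then
    LinearMap.toContinuousLinearMap
      ((InnerProductSpace.toDual ℝ (TangentSpace I x)).symm.toLinearEquiv.toLinearMap ∘ₛₗ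
        (TensorialAt.mkHom₂ (fun X Z ↦ koszul Y X Z x) x
          (fun _ hZ ↦ koszul_tensorial_left hY hZ)
          (fun _ hX ↦ koszul_tensorial_right hY hX)).toLinearMap)
  else 0

theorem inner_leviCivitaFun {x : M} {X Y Z : Π x : M, TangentSpace I x}
    (hY : MDiffAt (T% Y) x) (hX : MDiffAt (T% X) x) (hZ : MDiffAt (T% Z) x) :
    inner ℝ (leviCivitaFun Y x (X x)) (Z x) = koszul Y X Z x := by
  rw [leviCivitaFun, dif_pos hY]
  simp [TensorialAt.mkHom₂_apply _ _ hX hZ]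

theorem ext_of_inner {x : M} {A B : TangentSpace I x →L[ℝ] TangentSpace I x}
    (h : ∀ X Z : Π x : M, TangentSpace I x, MDiffAt (T% X) x → MDiffAt (T% Z) x →
      inner ℝ (A (X x)) (Z x) = inner ℝ (B (X x)) (Z x)) : A = B := by
  ext u
  refine ext_inner_right ℝ fun w ↦ ?_
  simpa using h _ _ (mdifferentiableAt_extend I E u) (mdifferentiableAt_extend I E w)

section
variable (I M)

/-- The Levi-Civita connection of the Riemannian manifold `M`. -/
def leviCivita : CovariantDerivative I E (fun x : M ↦ TangentSpace I x) where
  toFun := leviCivitaFun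
  isCovariantDerivativeOnUniv :=
    { add := fun {Y Y' x} hY hY' _ ↦ by
        refine ext_of_inner fun X Z hX hZ ↦ ?_
        have h1 := mvfderiv_fun_add (mdifferentiableAt_inner hY hZ) (mdifferentiableAt_inner hY' hZ)
        have h2 := mvfderiv_fun_add (mdifferentiableAt_inner hX hY) (mdifferentiableAt_inner hX hY')
        rw [add_apply, inner_add_left, inner_leviCivitaFun hY hX hZ,
          inner_leviCivitaFun hY' hX hZ,
          inner_leviCivitaFun (mdifferentiableAt_add_section hY hY') hX hZ]
        simp [koszul, inner_add_left, inner_add_right, h1, h2, mlieBracket_add_left hY hY',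
          mlieBracket_add_right hY hY']
        ring
      leibniz := fun {Y f x} hY hf _ ↦ by
        refine ext_of_inner fun X Z hX hZ ↦ ?_
        have h1 := mvfderiv_fun_mul hf (mdifferentiableAt_inner hY hZ)
        have h2 := mvfderiv_fun_mul hf (mdifferentiableAt_inner hX hY)
        rw [add_apply, inner_add_left, smul_apply,
          inner_smul_left, inner_leviCivitaFun hY hX hZ,
          inner_leviCivitaFun (hf.smul_section hY) hX hZ]
        simp [koszul, inner_smul_left, inner_smul_right, inner_add_left, h1, h2,
          mlieBracket_smul_left hf hY, mlieBracket_smul_right hf hY]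
        rw [real_inner_comm (X x) (Y x)]
        ring }

/-- The Levi-Civita connection is torsion-free. -/
theorem leviCivita_torsion : (leviCivita I M).torsion = 0 := by
  rw [CovariantDerivative.torsion_eq_zero_iff]
  intro X Y x hX hY
  refine ext_inner_right ℝ fun w ↦ ?_
  have hZ := mdifferentiableAt_extend I E w
  have h1 := inner_leviCivitaFun hY hX hZ
  have h2 := inner_leviCivitaFun hX hY hZ
  rw [extend_apply_self] at h1 h2
  change inner ℝ (leviCivitaFun Y x (X x) - leviCivitaFun X x (Y x)) w = _
  rw [inner_sub_left, h1, h2]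
  simp only [koszul, extend_apply_self]
  rw [mlieBracket_swap_apply (V := Y) (W := X), mlieBracket_swap_apply (V := X) (W := extend E w),
    mlieBracket_swap_apply (V := Y) (W := extend E w)]
  simp only [real_inner_comm, inner_neg_left]
  ring

/-- The Levi-Civita connection is compatible with the metric. -/
theorem leviCivita_metric (x : M) {X Y Z : Π x : M, TangentSpace I x}
    (hX : MDiffAt (T% X) x) (hY : MDiffAt (T% Y) x) (hZ : MDiffAt (T% Z) x) :
    mvfderiv I (fun y ↦ inner ℝ (Y y) (Z y)) x (X x) =
      inner ℝ (leviCivita I M Y x (X x)) (Z x) + inner ℝ (Y x) (leviCivita I M Z x (X x)) := by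
  rw [real_inner_comm _ (Y x)]
  change _ = inner ℝ (leviCivitaFun Y x (X x)) (Z x) + inner ℝ (leviCivitaFun Z x (X x)) (Y x)
  have hc : ∀ U V : Π x : M, TangentSpace I x,
      (fun y ↦ inner ℝ (U y) (V y)) = fun y ↦ inner ℝ (V y) (U y) :=
    fun U V ↦ funext fun y ↦ real_inner_comm _ _
  rw [inner_leviCivitaFun hY hX hZ, inner_leviCivitaFun hZ hX hY]
  simp only [koszul]
  rw [hc Z Y, hc Z X, hc X Y, mlieBracket_swap_apply (V := Z) (W := Y),
    mlieBracket_swap_apply (V := Z) (W := X), mlieBracket_swap_apply (V := Y) (W := X)]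
  simp only [inner_neg_left]
  ring

end

/-! ### Gradient and Hessian -/

/-- The gradient of `f`: `⟨grad f, v⟩ = df(v)`. -/
def gradient (f : M → ℝ) (x : M) : TangentSpace I x :=
  haveI : FiniteDimensional ℝ (TangentSpace I x) := inferInstanceAs (FiniteDimensional ℝ E)
  haveI : CompleteSpace (TangentSpace I x) := FiniteDimensional.complete ℝ _
  (InnerProductSpace.toDual ℝ (TangentSpace I x)).symm (mvfderiv I f x)

theorem inner_gradient (f : M → ℝ) (x : M) (v : TangentSpace I x) :
    inner ℝ (gradient f x) v = mvfderiv I f x v := by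
  simp [gradient]

section
variable (I)

/-- The Hessian `u^i v^j D_i D_j f = ⟨∇_u grad f, v⟩` of `f` at the point `x`. -/
def hessian (f : M → ℝ) (x : M) (u v : TangentSpace I x) : ℝ :=
  inner ℝ (leviCivita I M (gradient f) x u) v

/-- The Hessian as the covariant derivative of `df`:
`Hess f (X, Y) = X (df(Y)) - df(∇_X Y)`. -/
theorem hessian_eq {f : M → ℝ} {x : M} (hf : MDiffAt (T% (gradient (I := I) f)) x)
    {X Y : Π x : M, TangentSpace I x} (hX : MDiffAt (T% X) x) (hY : MDiffAt (T% Y) x) :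
    hessian I f x (X x) (Y x) =
      mvfderiv I (fun y ↦ mvfderiv I f y (Y y)) x (X x)
        - mvfderiv I f x (leviCivita I M Y x (X x)) := by
  have h := leviCivita_metric I M x hX hf hY
  simp only [inner_gradient] at h
  rw [h, hessian, add_sub_cancel_right]

/-- A function is convex if it is `C^∞` and its Hessian is positive semi-definite everywhere. -/
def IsConvexFunction (f : M → ℝ) : Prop :=
  ContMDiff I 𝓘(ℝ, ℝ) ∞ f ∧ ∀ (x : M) (v : TangentSpace I x), 0 ≤ hessian I f x v v

/-! ### Curvature -/

/-- The curvature operator on vector fields, at the point `x`: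
`R(X, Y)Z = ∇_X ∇_Y Z - ∇_Y ∇_X Z - ∇_[X, Y] Z`. -/
def curvatureOp (X Y Z : Π x : M, TangentSpace I x) (x : M) : TangentSpace I x :=
  leviCivita I M (fun y ↦ leviCivita I M Z y (Y y)) x (X x)
    - leviCivita I M (fun y ↦ leviCivita I M Z y (X y)) x (Y x)
    - leviCivita I M Z x (mlieBracket I X Y x)

/-- The Riemann curvature tensor at `x` as a function of four tangent vectors,
`R_{abcd} s^a t^b u^c v^d = ⟨R(S, T)V, U⟩`, where `S, T, V` are vector fields, smooth near `x`,
that extend `s, t, v` (the value does not depend on the choice of smooth extensions; those taken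
here are constant in the trivialization of the tangent bundle given by the chart at `x`).
With this sign convention `R_{abcd} s^a t^b s^c t^d` is the sectional curvature of the plane
spanned by an orthonormal pair `s, t`, so that it is positive on round spheres. -/
def riemannTensor (x : M) (s t u v : TangentSpace I x) : ℝ :=
  inner ℝ (curvatureOp I (extend E s) (extend E t) (extend E v) x) u

/-! ### Killing fields -/

/-- A smooth vector field `ξ` is a Killing field if it satisfies the Killing equation
`D_i ξ_j + D_j ξ_i = 0`. -/
def IsKillingField (ξ : Π x : M, TangentSpace I x) : Prop :=
  ContMDiff I I.tangent ∞ (T% ξ) ∧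
    ∀ (x : M) (u v : TangentSpace I x),
      inner ℝ (leviCivita I M ξ x u) v + inner ℝ (leviCivita I M ξ x v) u = 0

end

end

end RiemGeom

namespace RiemGeom

open Bundle VectorField FiberBundle Filter Topology
open scoped Manifold ContDiff

noncomputable section

set_option linter.unusedSectionVars false

variable {E : Type*} [NormedAddCommGroup E] [NormedSpace ℝ E] [FiniteDimensional ℝ E]
  {H : Type*} [TopologicalSpace H] {I : ModelWithCorners ℝ E H}
  {M : Type*} [TopologicalSpace M] [ChartedSpace H M] [IsManifold I ∞ M]
/-! ### Smooth functions and vector fields -/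

theorem eventually_mdifferentiableAt {x : M} {X : Π x : M, TangentSpace I x}
    (hX : CMDiffAt ∞ (T% X) x) : ∀ᶠ y in 𝓝 x, MDiffAt (T% X) y := by
  filter_upwards [(contMDiffAt_iff_contMDiffAt_nhds (n := 1) (by simp)).1
    (hX.of_le (by norm_cast))] with y hy
  exact hy.mdifferentiableAt one_ne_zero

theorem eventually_mdifferentiableAt_fun {x : M} {f : M → ℝ}
    (hf : CMDiffAt ∞ f x) : ∀ᶠ y in 𝓝 x, MDiffAt f y := by
  filter_upwards [(contMDiffAt_iff_contMDiffAt_nhds (n := 1) (by simp)).1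
    (hf.of_le (by norm_cast))] with y hy
  exact hy.mdifferentiableAt one_ne_zero

theorem mvfderiv_congr {x : M} {f g : M → ℝ} (h : f =ᶠ[𝓝 x] g) :
    mvfderiv I f x = mvfderiv I g x := by
  ext v
  simp only [mvfderiv, ContinuousLinearMap.comp_apply]
  rw [h.mfderiv_eq]
  rfl

theorem contMDiffAt_mlieBracket {x : M} {X Y : Π x : M, TangentSpace I x}
    (hX : CMDiffAt ∞ (T% X) x) (hY : CMDiffAt ∞ (T% Y) x) :
    CMDiffAt ∞ (T% (mlieBracket I X Y)) x := by
  have : IsManifold I (((⊤ : ℕ∞) : ℕ∞ω) + 1) M := inferInstanceAs (IsManifold I ∞ M)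
  have : IsManifold I (minSmoothness ℝ 2) M := IsManifold.of_le (n := ∞) (by simp; norm_cast)
  exact ContMDiffAt.mlieBracket_vectorField (m := ⊤) (n := ⊤) hX hY (by simp)

variable [RiemannianBundle (fun x : M ↦ TangentSpace I x)]
  [IsContMDiffRiemannianBundle I ∞ E (fun x : M ↦ TangentSpace I x)]

theorem contMDiffAt_inner {x : M} {X Y : Π x : M, TangentSpace I x}
    (hX : CMDiffAt ∞ (T% X) x) (hY : CMDiffAt ∞ (T% Y) x) :
    CMDiffAt ∞ (fun y ↦ (inner ℝ (X y) (Y y) : ℝ)) x :=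
  ContMDiffAt.inner_bundle (IB := I) (F := E) (E := fun x : M ↦ TangentSpace I x) hX hY

/-- The derivative of a smooth function along a smooth vector field is smooth. -/
theorem contMDiffAt_mvfderiv {x : M} {f : M → ℝ} {X : Π x : M, TangentSpace I x}
    (hf : CMDiffAt ∞ f x) (hX : CMDiffAt ∞ (T% X) x) :
    CMDiffAt ∞ (fun y ↦ mvfderiv I f y (X y)) x := by
  rcases subsingleton_or_nontrivial E with hE | hE
  · have h0 : (fun y ↦ mvfderiv I f y (X y)) = fun _ ↦ (0 : ℝ) := by
      funext y
      have : X y = 0 := hE.elim (α := E) _ _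
      simp [this]
    rw [h0]
    exact contMDiffAt_const
  obtain ⟨w, hw⟩ := exists_ne (0 : E)
  let W : Π x : M, TangentSpace I x := extend E (show TangentSpace I x from w)
  have hW : CMDiffAt ∞ (T% W) x := contMDiffAt_extend I E _
  have hWx : W x ≠ 0 := by
    rw [show W x = w from extend_apply_self ..]
    exact hw
  have h1 := contMDiffAt_inner (contMDiffAt_mlieBracket hX (hf.smul_section hW)) hW
  have h2 := hf.mul (contMDiffAt_inner (contMDiffAt_mlieBracket hX hW) hW)
  have hn := contMDiffAt_inner hW hW
  have hnx : (inner ℝ (W x) (W x) : ℝ) ≠ 0 := inner_self_ne_zero.2 hWx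
  have h3 := (h1.sub h2).div₀ hn hnx
  refine h3.congr_of_eventuallyEq ?_
  filter_upwards [eventually_mdifferentiableAt_fun hf, eventually_mdifferentiableAt hW,
    hn.continuousAt.eventually_ne hnx] with y hy hWy hny
  have := mlieBracket_smul_right (V := X) hy hWy
  simp only [Pi.div_apply, Pi.mul_apply, this, inner_add_left, real_inner_smul_left,
    eq_div_iff hny]
  ring

/-- The Lie bracket acts on smooth functions as the commutator of directional derivatives. -/
theorem mvfderiv_mlieBracket {x : M} {f : M → ℝ} {X Y : Π x : M, TangentSpace I x}
    (hf : CMDiffAt ∞ f x) (hX : CMDiffAt ∞ (T% X) x) (hY : CMDiffAt ∞ (T% Y) x) :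
    mvfderiv I f x (mlieBracket I X Y x) =
      mvfderiv I (fun y ↦ mvfderiv I f y (Y y)) x (X x)
        - mvfderiv I (fun y ↦ mvfderiv I f y (X y)) x (Y x) := by
  rcases subsingleton_or_nontrivial E with hE | hE
  · have h0 : ∀ v : TangentSpace I x, v = 0 := fun v ↦ hE.elim (α := E) _ _
    rw [h0 (mlieBracket I X Y x), h0 (X x), h0 (Y x)]
    simp
  obtain ⟨w, hw⟩ := exists_ne (0 : E)
  let W : Π x : M, TangentSpace I x := extend E (show TangentSpace I x from w)
  have hW : CMDiffAt ∞ (T% W) x := contMDiffAt_extend I E _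
  have hWx : W x ≠ 0 := by
    rw [show W x = w from extend_apply_self ..]
    exact hw
  have key : ∀ {X Y : Π x : M, TangentSpace I x}, CMDiffAt ∞ (T% X) x → CMDiffAt ∞ (T% Y) x →
      mlieBracket I X (mlieBracket I Y (f • W)) x =
        mvfderiv I (fun y ↦ mvfderiv I f y (Y y)) x (X x) • W x
          + mvfderiv I f x (Y x) • mlieBracket I X W x
          + mvfderiv I f x (X x) • mlieBracket I Y W x
          + f x • mlieBracket I X (mlieBracket I Y W) x := by
    intro X Y hX hY
    have hYf := (contMDiffAt_mvfderiv hf hY).mdifferentiableAt (by simp)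
    have hYW := (contMDiffAt_mlieBracket hY hW).mdifferentiableAt (by simp)
    have hf' := hf.mdifferentiableAt (n := ∞) (by simp)
    have hW' := hW.mdifferentiableAt (n := ∞) (by simp)
    have h1 : mlieBracket I Y (f • W) =ᶠ[𝓝 x]
        (fun y ↦ mvfderiv I f y (Y y)) • W + f • mlieBracket I Y W := by
      filter_upwards [eventually_mdifferentiableAt_fun hf, eventually_mdifferentiableAt hW]
        with y hfy hWy
      exact mlieBracket_smul_right hfy hWy
    rw [EventuallyEq.rfl.mlieBracket_vectorField_eq h1,
      mlieBracket_add_right (hYf.smul_section hW') (hf'.smul_section hYW),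
      mlieBracket_smul_right hYf hW', mlieBracket_smul_right hf' hYW]
    abel
  have h2 : ∀ {X : Π x : M, TangentSpace I x}, CMDiffAt ∞ (T% X) x →
      CMDiffAt (minSmoothness ℝ 2) (T% X) x := fun h ↦ h.of_le (by simp; norm_cast)
  have : IsManifold I (minSmoothness ℝ 3) M := IsManifold.of_le (n := ∞) (by simp; norm_cast)
  have J1 := leibniz_identity_mlieBracket_apply (h2 hX) (h2 hY) (h2 (hf.smul_section hW))
  have J2 := leibniz_identity_mlieBracket_apply (h2 hX) (h2 hY) (h2 hW)
  have h3 := mlieBracket_smul_right (V := mlieBracket I X Y)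
    (hf.mdifferentiableAt (n := ∞) (by simp)) (hW.mdifferentiableAt (n := ∞) (by simp))
  change mlieBracket I X (mlieBracket I Y (f • W)) x =
    mlieBracket I (mlieBracket I X Y) (f • W) x + mlieBracket I Y (mlieBracket I X (f • W)) x at J1
  rw [key hX hY, key hY hX, h3, J2] at J1
  have h4 : (mvfderiv I f x (mlieBracket I X Y x)
      - (mvfderiv I (fun y ↦ mvfderiv I f y (Y y)) x (X x)
        - mvfderiv I (fun y ↦ mvfderiv I f y (X y)) x (Y x))) • W x = 0 := by
    linear_combination (norm := module) -J1
  exact sub_eq_zero.1 ((smul_eq_zero.1 h4).resolve_right hWx)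

theorem contMDiffAt_det {ι : Type*} [Fintype ι] [DecidableEq ι] {x : M}
    {A : M → Matrix ι ι ℝ} (hA : ∀ i j, CMDiffAt ∞ (fun y ↦ A y i j) x) :
    CMDiffAt ∞ (fun y ↦ (A y).det) x := by
  simp only [Matrix.det_apply']
  exact contMDiffAt_finsetSum fun σ _ ↦ contMDiffAt_const.mul
    (contMDiffAt_finsetProd fun i _ ↦ hA _ _)

/-- A vector field is smooth if its inner products with all smooth vector fields are. -/
theorem contMDiffAt_of_inner {x : M} {X : Π x : M, TangentSpace I x}
    (h : ∀ Z : Π x : M, TangentSpace I x, CMDiffAt ∞ (T% Z) x →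
      CMDiffAt ∞ (fun y ↦ (inner ℝ (X y) (Z y) : ℝ)) x) :
    CMDiffAt ∞ (T% X) x := by
  classical
  let e := trivializationAt E (fun x : M ↦ TangentSpace I x) x
  let b := Module.finBasis ℝ E
  have hx : x ∈ e.baseSet := mem_baseSet_trivializationAt' x
  have hs : ∀ i, CMDiffAt ∞ (T% (e.localFrame b i)) x :=
    fun i ↦ contMDiffAt_localFrame_of_mem (I := I) ∞ e b i hx
  let G : M → Matrix _ _ ℝ := fun y ↦ Matrix.gram ℝ fun i ↦ e.localFrame b i y
  have hG : ∀ i j, CMDiffAt ∞ (fun y ↦ G y i j) x := fun i j ↦ contMDiffAt_inner (hs i) (hs j)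
  have hdet : ∀ y ∈ e.baseSet, (G y).det ≠ 0 := fun y hy ↦
    (Matrix.posDef_gram_of_linearIndependent
      ((e.isLocalFrameOn_localFrame_baseSet I ∞ b).linearIndependent hy)).det_pos.ne'
  rw [contMDiffAt_iff_localFrameCoeff b hx]
  intro i
  let c : M → Fin (Module.finrank ℝ E) → ℝ := fun y j ↦ e.localFrameCoeff I b j y (X y)
  let B : M → Fin (Module.finrank ℝ E) → ℝ := fun y j ↦ inner ℝ (X y) (e.localFrame b j y)
  have hGc : ∀ y ∈ e.baseSet, Matrix.mulVec (G y) (c y) = B y := by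
    intro y hy
    funext j
    have h1 := Trivialization.eq_sum_localFrameCoeff_smul (I := I) (b := b) (s := X) hy
    simp only [B]
    nth_rw 1 [h1]
    simp [G, c, Matrix.mulVec, dotProduct, Matrix.gram_apply, sum_inner,
      real_inner_smul_right, real_inner_comm, mul_comm]
  have hc : (fun y ↦ ((G y).updateCol i (B y)).det / (G y).det) =ᶠ[𝓝 x] fun y ↦ c y i := by
    filter_upwards [e.open_baseSet.mem_nhds hx] with y hy
    rw [div_eq_iff (hdet y hy), ← Matrix.cramer_apply, ← hGc y hy, Matrix.cramer_eq_adjugate_mulVec,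
      Matrix.mulVec_mulVec, Matrix.adjugate_mul]
    simp [Matrix.smul_mulVec, mul_comm]
  refine ContMDiffAt.congr_of_eventuallyEq ?_ hc.symm
  refine (contMDiffAt_det fun j k ↦ ?_).div₀ (contMDiffAt_det hG) (hdet x hx)
  by_cases hk : k = i
  · subst hk
    simpa [B] using h _ (hs j)
  · simpa [Matrix.updateCol_apply, hk] using hG j k

/-! ### Covariant derivatives of vector fields -/

/-- The covariant derivative `∇_X Y` of the vector field `Y` along the vector field `X`. -/
def covDeriv (X Y : Π x : M, TangentSpace I x) (x : M) : TangentSpace I x :=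
  leviCivita I M Y x (X x)

theorem covDeriv_congr {x : M} {X Y Y' : Π x : M, TangentSpace I x}
    (hY : MDiffAt (T% Y) x) (hY' : MDiffAt (T% Y') x) (h : ∀ᶠ y in 𝓝 x, Y y = Y' y) :
    covDeriv X Y x = covDeriv X Y' x := by
  have := (leviCivita I M).isCovariantDerivativeOnUniv.congr_of_eventuallyEq hY hY' univ_mem h
  exact congrArg (· (X x)) this

theorem covDeriv_add {x : M} {X Y Y' : Π x : M, TangentSpace I x}
    (hY : MDiffAt (T% Y) x) (hY' : MDiffAt (T% Y') x) :
    covDeriv X (Y + Y') x = covDeriv X Y x + covDeriv X Y' x := by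
  have := (leviCivita I M).isCovariantDerivativeOnUniv.add hY hY'
  exact congrArg (· (X x)) this

theorem covDeriv_sub_covDeriv {x : M} {X Y : Π x : M, TangentSpace I x}
    (hX : MDiffAt (T% X) x) (hY : MDiffAt (T% Y) x) :
    covDeriv X Y x - covDeriv Y X x = mlieBracket I X Y x :=
  (leviCivita I M).torsion_eq_zero_iff.1 (leviCivita_torsion I M) hX hY

theorem mvfderiv_inner {x : M} {X Y Z : Π x : M, TangentSpace I x}
    (hX : MDiffAt (T% X) x) (hY : MDiffAt (T% Y) x) (hZ : MDiffAt (T% Z) x) :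
    mvfderiv I (fun y ↦ inner ℝ (Y y) (Z y)) x (X x) =
      inner ℝ (covDeriv X Y x) (Z x) + inner ℝ (Y x) (covDeriv X Z x) :=
  leviCivita_metric I M x hX hY hZ

theorem contMDiffAt_covDeriv {x : M} {X Y : Π x : M, TangentSpace I x}
    (hX : CMDiffAt ∞ (T% X) x) (hY : CMDiffAt ∞ (T% Y) x) :
    CMDiffAt ∞ (T% (covDeriv X Y)) x := by
  refine contMDiffAt_of_inner fun Z hZ ↦ ?_
  have h : (fun y ↦ (inner ℝ (covDeriv X Y y) (Z y) : ℝ)) =ᶠ[𝓝 x] koszul Y X Z := by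
    filter_upwards [eventually_mdifferentiableAt hX, eventually_mdifferentiableAt hY,
      eventually_mdifferentiableAt hZ] with y hXy hYy hZy
    exact inner_leviCivitaFun hYy hXy hZy
  refine ContMDiffAt.congr_of_eventuallyEq ?_ h
  exact contMDiffAt_const.mul
    ((((((contMDiffAt_mvfderiv (contMDiffAt_inner hY hZ) hX).add
      (contMDiffAt_mvfderiv (contMDiffAt_inner hZ hX) hY)).sub
      (contMDiffAt_mvfderiv (contMDiffAt_inner hX hY) hZ)).add
      (contMDiffAt_inner (contMDiffAt_mlieBracket hX hY) hZ)).sub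
      (contMDiffAt_inner (contMDiffAt_mlieBracket hY hZ) hX)).add
      (contMDiffAt_inner (contMDiffAt_mlieBracket hZ hX) hY))

/-! ### Symmetries of the curvature -/

theorem curvatureOp_eq (X Y Z : Π x : M, TangentSpace I x) (x : M) :
    curvatureOp I X Y Z x = covDeriv X (covDeriv Y Z) x - covDeriv Y (covDeriv X Z) x
      - covDeriv (mlieBracket I X Y) Z x := rfl

theorem curvatureOp_swap (X Y Z : Π x : M, TangentSpace I x) (x : M) :
    curvatureOp I X Y Z x = -curvatureOp I Y X Z x := by
  simp only [curvatureOp, mlieBracket_swap_apply (V := X) (W := Y), map_neg]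
  abel

theorem inner_curvatureOp_swap {x : M} {X Y Z W : Π x : M, TangentSpace I x}
    (hX : CMDiffAt ∞ (T% X) x) (hY : CMDiffAt ∞ (T% Y) x) (hZ : CMDiffAt ∞ (T% Z) x)
    (hW : CMDiffAt ∞ (T% W) x) :
    inner ℝ (curvatureOp I X Y Z x) (W x) = -inner ℝ (curvatureOp I X Y W x) (Z x) := by
  have d : ∀ {X : Π x : M, TangentSpace I x}, CMDiffAt ∞ (T% X) x → MDiffAt (T% X) x :=
    fun h ↦ h.mdifferentiableAt (by simp)
  have key : ∀ {X Y : Π x : M, TangentSpace I x}, CMDiffAt ∞ (T% X) x → CMDiffAt ∞ (T% Y) x →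
      mvfderiv I (fun y ↦ mvfderiv I (fun z ↦ inner ℝ (Z z) (W z)) y (Y y)) x (X x) =
        inner ℝ (covDeriv X (covDeriv Y Z) x) (W x) + inner ℝ (covDeriv Y Z x) (covDeriv X W x)
        + (inner ℝ (covDeriv X Z x) (covDeriv Y W x)
          + inner ℝ (Z x) (covDeriv X (covDeriv Y W) x)) := by
    intro X Y hX hY
    have h : (fun y ↦ mvfderiv I (fun z ↦ inner ℝ (Z z) (W z)) y (Y y)) =ᶠ[𝓝 x]
        fun y ↦ inner ℝ (covDeriv Y Z y) (W y) + inner ℝ (Z y) (covDeriv Y W y) := by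
      filter_upwards [eventually_mdifferentiableAt hY, eventually_mdifferentiableAt hZ,
        eventually_mdifferentiableAt hW] with y hYy hZy hWy
      exact mvfderiv_inner hYy hZy hWy
    have hYZ := d (contMDiffAt_covDeriv hY hZ)
    have hYW := d (contMDiffAt_covDeriv hY hW)
    rw [mvfderiv_congr h, mvfderiv_fun_add (mdifferentiableAt_inner hYZ (d hW))
      (mdifferentiableAt_inner (d hZ) hYW), add_apply,
      mvfderiv_inner (d hX) hYZ (d hW), mvfderiv_inner (d hX) (d hZ) hYW]
  have h1 := mvfderiv_mlieBracket (contMDiffAt_inner hZ hW) hX hY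
  rw [key hX hY, key hY hX,
    mvfderiv_inner (d (contMDiffAt_mlieBracket hX hY)) (d hZ) (d hW)] at h1
  simp only [curvatureOp_eq, inner_sub_left]
  simp only [real_inner_comm (Z x)] at h1 ⊢
  linarith

/-- The first Bianchi identity. -/
theorem curvatureOp_bianchi {x : M} {X Y Z : Π x : M, TangentSpace I x}
    (hX : CMDiffAt ∞ (T% X) x) (hY : CMDiffAt ∞ (T% Y) x) (hZ : CMDiffAt ∞ (T% Z) x) :
    curvatureOp I X Y Z x + curvatureOp I Y Z X x + curvatureOp I Z X Y x = 0 := by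
  have d : ∀ {X : Π x : M, TangentSpace I x}, CMDiffAt ∞ (T% X) x → MDiffAt (T% X) x :=
    fun h ↦ h.mdifferentiableAt (by simp)
  have key : ∀ {X Y Z : Π x : M, TangentSpace I x}, CMDiffAt ∞ (T% X) x → CMDiffAt ∞ (T% Y) x →
      CMDiffAt ∞ (T% Z) x → covDeriv X (covDeriv Y Z) x =
        covDeriv X (covDeriv Z Y) x + covDeriv (mlieBracket I Y Z) X x
          + mlieBracket I X (mlieBracket I Y Z) x := by
    intro X Y Z hX hY hZ
    have hB := d (contMDiffAt_mlieBracket hY hZ)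
    have hZY := d (contMDiffAt_covDeriv hZ hY)
    rw [← covDeriv_sub_covDeriv (d hX) hB, add_assoc, add_sub_cancel, ← covDeriv_add hZY hB]
    refine covDeriv_congr (d (contMDiffAt_covDeriv hY hZ)) (mdifferentiableAt_add_section hZY hB) ?_
    filter_upwards [eventually_mdifferentiableAt hY, eventually_mdifferentiableAt hZ] with y hYy hZy
    rw [Pi.add_apply, ← covDeriv_sub_covDeriv hYy hZy, add_sub_cancel]
  have h2 : ∀ {X : Π x : M, TangentSpace I x}, CMDiffAt ∞ (T% X) x →
      CMDiffAt (minSmoothness ℝ 2) (T% X) x := fun h ↦ h.of_le (by simp; norm_cast)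
  have : IsManifold I (minSmoothness ℝ 3) M := IsManifold.of_le (n := ∞) (by simp; norm_cast)
  have J := leibniz_identity_mlieBracket_apply (h2 hX) (h2 hY) (h2 hZ)
  rw [mlieBracket_swap_apply (V := mlieBracket I X Y), mlieBracket_swap (V := X) (W := Z)] at J
  have hneg : mlieBracket I Y (-mlieBracket I Z X) x = -mlieBracket I Y (mlieBracket I Z X) x := by
    have := mlieBracket_const_smul_right (I := I) (c := (-1 : ℝ)) (V := Y)
      (d (contMDiffAt_mlieBracket hZ hX))
    simpa using this
  rw [hneg] at J
  simp only [curvatureOp_eq]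
  rw [key hX hY hZ, key hY hZ hX, key hZ hX hY]
  linear_combination (norm := module) J

theorem inner_curvatureOp_pair_swap {x : M} {X Y Z W : Π x : M, TangentSpace I x}
    (hX : CMDiffAt ∞ (T% X) x) (hY : CMDiffAt ∞ (T% Y) x) (hZ : CMDiffAt ∞ (T% Z) x)
    (hW : CMDiffAt ∞ (T% W) x) :
    inner ℝ (curvatureOp I X Y Z x) (W x) = inner ℝ (curvatureOp I Z W X x) (Y x) := by
  let S : Type _ := {X : Π x : M, TangentSpace I x // CMDiffAt ∞ (T% X) x}
  let R : S → S → S → S → ℝ := fun A B C D ↦ inner ℝ (curvatureOp I A.1 B.1 C.1 x) (D.1 x)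
  have s1 : ∀ A B C D, R A B C D = -R B A C D := fun A B C D ↦ by
    simp only [R]
    rw [curvatureOp_swap, inner_neg_left]
  have s2 : ∀ A B C D, R A B C D = -R A B D C := fun A B C D ↦
    inner_curvatureOp_swap A.2 B.2 C.2 D.2
  have s3 : ∀ A B C D, R A B C D + R B C A D + R C A B D = 0 := fun A B C D ↦ by
    simp only [R, ← inner_add_left]
    rw [curvatureOp_bianchi A.2 B.2 C.2, inner_zero_left]
  have key : ∀ A B C D, R A B C D = R C D A B := fun A B C D ↦ by
    linarith [s3 A B C D, s3 B C D A, s3 C D A B, s3 D A B C, s1 A B D C, s1 B C A D, s1 C A B D,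
      s1 C D A B, s1 D A C B, s1 B D C A, s2 A B C D, s2 B C A D, s2 C A B D, s2 C D A B,
      s2 B C D A, s2 C D B A, s2 D B C A, s2 D A B C, s2 A C D B, s2 A B D C, s2 B D A C,
      s1 A C D B, s1 D B C A, s1 A D C B]
  exact key ⟨X, hX⟩ ⟨Y, hY⟩ ⟨Z, hZ⟩ ⟨W, hW⟩

/-- The curvature depends on the vector fields only through their values at the point. -/
theorem inner_curvatureOp_congr {x : M} {X Y Z W X' Y' Z' W' : Π x : M, TangentSpace I x}
    (hX : CMDiffAt ∞ (T% X) x) (hY : CMDiffAt ∞ (T% Y) x) (hZ : CMDiffAt ∞ (T% Z) x)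
    (hW : CMDiffAt ∞ (T% W) x) (hX' : CMDiffAt ∞ (T% X') x) (hY' : CMDiffAt ∞ (T% Y') x)
    (hZ' : CMDiffAt ∞ (T% Z') x) (hXX : X x = X' x) (hYY : Y x = Y' x) (hZZ : Z x = Z' x)
    (hWW : W x = W' x) :
    inner ℝ (curvatureOp I X Y Z x) (W x) = inner ℝ (curvatureOp I X' Y' Z' x) (W' x) := by
  rw [← hWW, inner_curvatureOp_swap hX hY hZ hW, hZZ, ← inner_curvatureOp_swap hX hY hZ' hW,
    inner_curvatureOp_pair_swap hX hY hZ' hW, hYY, ← inner_curvatureOp_pair_swap hX hY' hZ' hW,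
    curvatureOp_swap, inner_neg_left, inner_curvatureOp_pair_swap hY' hX hZ' hW, hXX,
    ← inner_curvatureOp_pair_swap hY' hX' hZ' hW, ← inner_neg_left, ← curvatureOp_swap]

/-! ### The Hessian of half the squared length of a Killing field -/

theorem covDeriv_neg {x : M} {X Y : Π x : M, TangentSpace I x} (hY : MDiffAt (T% Y) x) :
    covDeriv X (-Y) x = -covDeriv X Y x := by
  have := (leviCivita I M).isCovariantDerivativeOnUniv.smul_const (-1) hY
  simpa [covDeriv] using congrArg (· (X x)) this

theorem hessian_symm {f : M → ℝ} {x : M} {U V : Π x : M, TangentSpace I x}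
    (hf : CMDiffAt ∞ f x) (hg : MDiffAt (T% (gradient (I := I) f)) x)
    (hU : CMDiffAt ∞ (T% U) x) (hV : CMDiffAt ∞ (T% V) x) :
    hessian I f x (U x) (V x) = hessian I f x (V x) (U x) := by
  have hU' := hU.mdifferentiableAt (n := ∞) (by simp)
  have hV' := hV.mdifferentiableAt (n := ∞) (by simp)
  have h := mvfderiv_mlieBracket hf hU hV
  rw [← covDeriv_sub_covDeriv hU' hV', map_sub] at h
  rw [hessian_eq I hg hU' hV', hessian_eq I hg hV' hU']
  simp only [covDeriv] at h
  linarith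

namespace IsKillingField

variable {ξ : Π x : M, TangentSpace I x} {f : M → ℝ}

theorem inner_swap (hξ : IsKillingField I ξ) (x : M) (u v : TangentSpace I x) :
    inner ℝ (leviCivita I M ξ x u) v = -inner ℝ (leviCivita I M ξ x v) u :=
  eq_neg_of_add_eq_zero_left (hξ.2 x u v)

theorem contMDiff_halfNormSq (hξ : IsKillingField I ξ)
    (hf : ∀ x, f x = 1 / 2 * inner ℝ (ξ x) (ξ x)) : CMDiff ∞ f := by
  intro x
  rw [funext hf]
  exact contMDiffAt_const.mul (contMDiffAt_inner (hξ.1 x) (hξ.1 x))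

theorem gradient_halfNormSq (hξ : IsKillingField I ξ)
    (hf : ∀ x, f x = 1 / 2 * inner ℝ (ξ x) (ξ x)) : gradient (I := I) f = -covDeriv ξ ξ := by
  funext x
  refine ext_inner_right ℝ fun v ↦ ?_
  have hd := (hξ.1 x).mdifferentiableAt (n := ∞) (by simp)
  have h := mvfderiv_inner (mdifferentiableAt_extend I E v) hd hd
  have h2 := mvfderiv_fun_mul (mdifferentiableAt_const (c := (1 / 2 : ℝ)))
    (mdifferentiableAt_inner hd hd)
  rw [inner_gradient, funext hf, h2]
  simp only [covDeriv, extend_apply_self] at h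
  simp only [mvfderiv_const, smul_zero, add_zero, smul_apply, smul_eq_mul, h, Pi.neg_apply,
    inner_neg_left, covDeriv]
  rw [real_inner_comm _ (ξ x), hξ.inner_swap x v]
  ring

theorem hessian_halfNormSq (hξ : IsKillingField I ξ)
    (hf : ∀ x, f x = 1 / 2 * inner ℝ (ξ x) (ξ x)) (x : M) (u v : TangentSpace I x) :
    hessian I f x u v = inner ℝ (leviCivita I M ξ x u) (leviCivita I M ξ x v)
      - riemannTensor I x u (ξ x) v (ξ x) := by
  have d : ∀ {X : Π x : M, TangentSpace I x}, CMDiffAt ∞ (T% X) x → MDiffAt (T% X) x :=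
    fun h ↦ h.mdifferentiableAt (by simp)
  have hs : CMDiffAt ∞ (T% ξ) x := hξ.1 x
  have hss := contMDiffAt_covDeriv hs hs
  have hR : ∀ {U V : Π x : M, TangentSpace I x}, CMDiffAt ∞ (T% U) x → CMDiffAt ∞ (T% V) x →
      hessian I f x (U x) (V x) = inner ℝ (covDeriv U ξ x) (covDeriv V ξ x)
        - inner ℝ (curvatureOp I U ξ ξ x) (V x)
        - (inner ℝ (covDeriv ξ (covDeriv U ξ) x) (V x)
          - inner ℝ (leviCivita I M ξ x (covDeriv ξ U x)) (V x)) := by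
    intro U V hU hV
    have h1 : hessian I f x (U x) (V x) = -inner ℝ (covDeriv U (covDeriv ξ ξ) x) (V x) := by
      rw [hessian, hξ.gradient_halfNormSq hf, ← inner_neg_left, ← covDeriv_neg (d hss)]
      rfl
    have h2 : covDeriv (mlieBracket I U ξ) ξ x =
        leviCivita I M ξ x (covDeriv U ξ x) - leviCivita I M ξ x (covDeriv ξ U x) := by
      rw [← map_sub, covDeriv_sub_covDeriv (d hU) (d hs)]
      rfl
    have h3 := hξ.inner_swap x (covDeriv U ξ x) (V x)
    rw [real_inner_comm] at h3
    rw [h1, curvatureOp_eq, h2]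
    simp only [inner_sub_left]
    rw [real_inner_comm (V x) (leviCivita I M ξ x (covDeriv U ξ x)), h3]
    rw [real_inner_comm (covDeriv V ξ x)]
    simp only [covDeriv]
    ring
  have hT : ∀ {U V : Π x : M, TangentSpace I x}, CMDiffAt ∞ (T% U) x → CMDiffAt ∞ (T% V) x →
      (inner ℝ (covDeriv ξ (covDeriv U ξ) x) (V x)
          - inner ℝ (leviCivita I M ξ x (covDeriv ξ U x)) (V x))
        + (inner ℝ (covDeriv ξ (covDeriv V ξ) x) (U x)
          - inner ℝ (leviCivita I M ξ x (covDeriv ξ V x)) (U x)) = 0 := by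
    intro U V hU hV
    have hUs := d (contMDiffAt_covDeriv hU hs)
    have hVs := d (contMDiffAt_covDeriv hV hs)
    have h1 : (fun y ↦ inner ℝ (covDeriv U ξ y) (V y) + inner ℝ (covDeriv V ξ y) (U y)) =
        fun _ ↦ (0 : ℝ) := funext fun y ↦ hξ.2 y (U y) (V y)
    have h2 := mvfderiv_fun_add (mdifferentiableAt_inner hUs (d hV))
      (mdifferentiableAt_inner hVs (d hU))
    rw [h1, mvfderiv_const] at h2
    have h3 := congrArg (· (ξ x)) h2
    simp only [zero_apply, add_apply, mvfderiv_inner (d hs) hUs (d hV),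
      mvfderiv_inner (d hs) hVs (d hU)] at h3
    have h4 := hξ.inner_swap x (U x) (covDeriv ξ V x)
    have h5 := hξ.inner_swap x (V x) (covDeriv ξ U x)
    simp only [covDeriv] at h3 h4 h5 ⊢
    linarith
  let U : Π x : M, TangentSpace I x := extend E u
  let V : Π x : M, TangentSpace I x := extend E v
  have hU : CMDiffAt ∞ (T% U) x := contMDiffAt_extend I E u
  have hV : CMDiffAt ∞ (T% V) x := contMDiffAt_extend I E v
  have hUx : U x = u := extend_apply_self ..
  have hVx : V x = v := extend_apply_self ..
  have hg : MDiffAt (T% (gradient (I := I) f)) x := by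
    rw [hξ.gradient_halfNormSq hf]
    exact mdifferentiableAt_neg_section (d hss)
  have e1 := hR hU hV
  have e2 := hR hV hU
  have e3 := hT hU hV
  have e4 := hessian_symm (hξ.contMDiff_halfNormSq hf x) hg hU hV
  have e5 : inner ℝ (curvatureOp I U ξ ξ x) (V x) = inner ℝ (curvatureOp I V ξ ξ x) (U x) := by
    rw [inner_curvatureOp_pair_swap hU hs hs hV, curvatureOp_swap, inner_neg_left,
      inner_curvatureOp_swap hV hs hU hs, neg_neg]
  have e6 : riemannTensor I x u (ξ x) v (ξ x) = inner ℝ (curvatureOp I U ξ ξ x) (V x) := by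
    have hx : CMDiffAt ∞ (T% (extend E (ξ x))) x := contMDiffAt_extend I E (ξ x)
    rw [riemannTensor, ← hVx]
    exact inner_curvatureOp_congr hU hx hx hV hU hs hs rfl (extend_apply_self ..)
      (extend_apply_self ..) rfl
  rw [real_inner_comm] at e2
  rw [e6, ← hUx, ← hVx]
  simp only [covDeriv] at e1 e2 e3 ⊢
  linarith

end IsKillingField

end

end RiemGeom

open Bundle in
open scoped Manifold ContDiff in
theorem mainTheorem6
    {E : Type*} [NormedAddCommGroup E] [NormedSpace ℝ E] [FiniteDimensional ℝ E]
    {H : Type*} [TopologicalSpace H] (I : ModelWithCorners ℝ E H)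
    {M : Type*} [TopologicalSpace M] [ChartedSpace H M] [IsManifold I ∞ M]
    [BoundarylessManifold I M]
    [RiemannianBundle (fun x : M ↦ TangentSpace I x)]
    [IsContMDiffRiemannianBundle I ∞ E (fun x : M ↦ TangentSpace I x)]
    (ξ : Π x : M, TangentSpace I x) (hξ : RiemGeom.IsKillingField I ξ)
    (f : M → ℝ) (hf : ∀ x, f x = 1 / 2 * inner ℝ (ξ x) (ξ x)) :
    (∀ (x : M) (u v : TangentSpace I x),
      RiemGeom.hessian I f x u v =
        inner ℝ (RiemGeom.leviCivita I M ξ x u) (RiemGeom.leviCivita I M ξ x v)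
          - RiemGeom.riemannTensor I x u (ξ x) v (ξ x)) ∧
    ((∀ (x : M) (u : TangentSpace I x), RiemGeom.riemannTensor I x u (ξ x) u (ξ x) ≤ 0) →
      RiemGeom.IsConvexFunction I f) := by
  refine ⟨hξ.hessian_halfNormSq hf, fun h ↦ ⟨hξ.contMDiff_halfNormSq hf, fun x v ↦ ?_⟩⟩
  rw [hξ.hessian_halfNormSq hf]
  linarith [h x v, real_inner_self_nonneg (x := RiemGeom.leviCivita I M ξ x v)]
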